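/- For integers $d\ge 1$, $k_1\ge 2$ and $k_2,\dots,k_d\ge 1$, let \[ \zeta^{\star}(k_1,\dots,k_d)=\sum_{n_1\ge n_2\ge\cdots\ge n_d\ge 1}\frac{1}{n_1^{k_1}n_2^{k_2}\cdots n_d^{k_d}} \] be the multiple zeta-star value, and let $\zeta$ be the Riemann zeta function. **Theorem (cyclic sum formula for multiple zeta-star values).** Let $l\ge 1$ and let $k_1,\dots,k_l$ be positive integers, not all equal to $1$. Extend the subscripts cyclically by putting $k_j=k_{j'}$ whenever $j\equiv j'\pmod l$. Then all the series below converge, and \[ \sum_{j=1}^{l}\sum_{i=1}^{k_j-1}\zeta^{\star}(k_j-i+1,\,k_{j+1},\dots,k_{j+l-1},\,i)=(k_1+\cdots+k_l)\,\zeta(k_1+\cdots+k_l+1). \] -/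

import Mathlib

/-- The summation range `n₁ ≥ n₂ ≥ ⋯ ≥ n_d ≥ 1` of the multiple zeta-star values of depth `d`. -/
def StarRange (d : ℕ) : Type :=
  {n : Fin d → ℕ // Antitone n ∧ ∀ m, 1 ≤ n m}

/-- The general term `1 / (n₁ ^ k₁ ⋯ n_d ^ k_d)` of the series defining `ζ⋆(k₁, …, k_d)`. -/
noncomputable def zetaStarTerm {d : ℕ} (k : Fin d → ℕ) (n : StarRange d) : ℝ :=
  1 / ∏ m, (n.1 m : ℝ) ^ k m

/-- The multiple zeta-star value
`ζ⋆(k₁, …, k_d) = ∑_{n₁ ≥ ⋯ ≥ n_d ≥ 1} 1 / (n₁ ^ k₁ ⋯ n_d ^ k_d)`,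
meaningful for positive integers `k₁, …, k_d` with `k₁ ≥ 2`. -/
noncomputable def zetaStar {d : ℕ} (k : Fin d → ℕ) : ℝ :=
  ∑' n : StarRange d, zetaStarTerm k n

/-- The index `(k_j - i + 1, k_{j+1}, …, k_{j+l-1}, i)` of depth `l + 1`, where the subscripts
of `k` are read modulo `l` (addition in `Fin l` is addition modulo `l`). -/
def cyclicIndex {l : ℕ} [NeZero l] (k : Fin l → ℕ) (j : Fin l) (i : ℕ) : Fin (l + 1) → ℕ :=
  Fin.snoc (α := fun _ => ℕ)
    (Function.update (fun m : Fin l => k (j + m)) 0 (k j - i + 1)) i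

/-! The argument is that of Ohno and Wakabayashi. Write `S` for the sum of the `k_j` and `C(k, i)`
for the series of `cyclicTerm k i`. The partial fraction identity in `cyclicTerm_add` moves one
power from `n₁` to the last entry `m` at the cost of a star term with `n₁ ≠ m`; restoring its
diagonal costs `ζ(S + 1)`. After `k₁ - 1` moves a single power of `n₁` is left. The sum over `n₁`
then telescopes into a sum over a new last entry, so `C(k, k₁ - 1)` is `C(k', 0) + ζ(S + 1)` with
`k'` the rotated index (`tsum_cyclicTerm_rotate`). One shift thus contributes `k₁ ζ(S + 1)`. Summed
over all rotations, the series `C` cancel, provided they are finite. Working in `[0, ∞]` makes every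
rearrangement free; finiteness is needed only for this cancellation and for the return to real
numbers. -/

open Finset

/-! ### Chains: adding an entry at either end, and the diagonal. -/

namespace StarRange

theorem pos {d : ℕ} (n : StarRange d) (x : Fin d) : (0 : ℝ) < n.1 x :=
  Nat.cast_pos.2 (n.2.2 x)

/-- Prepending an entry to a chain: `(t, r)` corresponds to the chain `(t₁ + r, t₁, t₂, …)`. -/
def consEquiv (L : ℕ) : StarRange (L + 1) × ℕ ≃ StarRange (L + 2) where
  toFun t := ⟨Fin.cons (t.1.1 0 + t.2) t.1.1, by
    constructor
    · rw [Fin.antitone_iff_succ_le]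
      intro x
      refine Fin.cases ?_ (fun y => ?_) x
      · simp
      · rw [Fin.cons_succ, ← Fin.succ_castSucc, Fin.cons_succ]
        exact t.1.2.1 (Fin.castSucc_lt_succ).le
    · intro x
      refine Fin.cases ?_ (fun y => ?_) x
      · rw [Fin.cons_zero]
        exact (t.1.2.2 0).trans (Nat.le_add_right _ _)
      · rw [Fin.cons_succ]
        exact t.1.2.2 y⟩
  invFun n := (⟨fun x => n.1 x.succ,
    fun _ _ h => n.2.1 (Fin.succ_le_succ_iff.2 h), fun x => n.2.2 _⟩,
    n.1 0 - n.1 (Fin.succ 0))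
  left_inv t := by
    refine Prod.ext (Subtype.ext ?_) ?_
    · funext x
      simp
    · simp
  right_inv n := by
    refine Subtype.ext ?_
    funext x
    refine Fin.cases ?_ (fun y => ?_) x
    · have : n.1 (Fin.succ 0) ≤ n.1 0 := n.2.1 (Fin.zero_le _)
      simp only [Fin.cons_zero]
      omega
    · simp

theorem consEquiv_val {L : ℕ} (t : StarRange (L + 1)) (r : ℕ) :
    (consEquiv L (t, r)).1 = Fin.cons (t.1 0 + r) t.1 :=
  rfl

/-- Appending an entry to a chain: `(t, p)` corresponds to the chain `(…, t_d, p + 1)`. -/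
def snocChain {L : ℕ} (t : StarRange (L + 1)) (p : Fin (t.1 (Fin.last L))) :
    StarRange (L + 2) :=
  ⟨Fin.snoc (α := fun _ => ℕ) t.1 (p + 1 : ℕ), by
    constructor
    · rw [Fin.antitone_iff_succ_le]
      intro x
      refine Fin.lastCases ?_ (fun y => ?_) x
      · rw [Fin.succ_last, Fin.snoc_last, Fin.snoc_castSucc]
        exact p.2
      · rw [Fin.succ_castSucc, Fin.snoc_castSucc, Fin.snoc_castSucc]
        exact t.2.1 (Fin.castSucc_lt_succ).le
    · intro x
      refine Fin.lastCases ?_ (fun y => ?_) x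
      · rw [Fin.snoc_last]
        omega
      · rw [Fin.snoc_castSucc]
        exact t.2.2 y⟩

theorem snocChain_bijective (L : ℕ) :
    Function.Bijective (fun s : (t : StarRange (L + 1)) × Fin (t.1 (Fin.last L)) =>
      snocChain s.1 s.2) := by
  constructor
  · rintro ⟨t, p⟩ ⟨t', p'⟩ h
    have h' : Fin.snoc (α := fun _ => ℕ) t.1 (p + 1 : ℕ)
        = Fin.snoc (α := fun _ => ℕ) t'.1 (p' + 1 : ℕ) := congrArg Subtype.val h
    have ht : t = t' := Subtype.ext (funext fun x => by
      simpa using congrFun h' x.castSucc)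
    subst ht
    have hp : p = p' := Fin.ext (by simpa using congrFun h' (Fin.last _))
    rw [hp]
  · intro n
    have h1 := n.2.2 (Fin.last _)
    have h2 : n.1 (Fin.last _) ≤ n.1 (Fin.last L).castSucc := n.2.1 (Fin.le_last _)
    refine ⟨⟨⟨fun x => n.1 x.castSucc, fun _ _ h => n.2.1 (Fin.castSucc_le_castSucc_iff.2 h),
      fun x => n.2.2 _⟩, ⟨n.1 (Fin.last _) - 1, by dsimp only; omega⟩⟩, Subtype.ext ?_⟩
    funext x
    refine Fin.lastCases ?_ (fun y => ?_) x
    · simp only [snocChain, Fin.snoc_last]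
      omega
    · simp only [snocChain, Fin.snoc_castSucc]

theorem tsum_eq_cons {L : ℕ} (f : StarRange (L + 2) → ENNReal) :
    ∑' n, f n = ∑' t : StarRange (L + 1), ∑' r : ℕ, f (consEquiv L (t, r)) := by
  rw [← (consEquiv L).tsum_eq, ENNReal.tsum_prod']

theorem tsum_eq_snoc {L : ℕ} (f : StarRange (L + 2) → ENNReal) :
    ∑' n, f n = ∑' t : StarRange (L + 1), ∑ p : Fin (t.1 (Fin.last L)), f (snocChain t p) := by
  rw [← (Equiv.ofBijective _ (snocChain_bijective L)).tsum_eq, ENNReal.tsum_sigma']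
  simp only [tsum_fintype, Equiv.ofBijective_apply]

theorem eq_of_first_eq_last {d : ℕ} (n : StarRange (d + 1)) (h : n.1 0 = n.1 (Fin.last d))
    (x : Fin (d + 1)) : n.1 x = n.1 0 :=
  le_antisymm (n.2.1 (Fin.zero_le x)) (h.trans_le (n.2.1 (Fin.le_last x)))

/-- The diagonal part of a multiple zeta-star series is a zeta value. -/
theorem tsum_diagonal {d : ℕ} (e : Fin (d + 1) → ℕ) :
    ∑' n : StarRange (d + 1), (if n.1 0 = n.1 (Fin.last d) then
      ENNReal.ofReal (zetaStarTerm e n) else 0)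
      = ∑' c : ℕ, ENNReal.ofReal (1 / ((c + 1 : ℕ) : ℝ) ^ (∑ x, e x)) := by
  let g : ℕ → StarRange (d + 1) := fun c =>
    ⟨fun _ => c + 1, antitone_const, fun _ => Nat.le_add_left _ _⟩
  have hg : Function.Injective g := fun a b h => by
    have := congrFun (congrArg Subtype.val h) 0
    simpa [g] using this
  rw [← hg.tsum_eq]
  · refine tsum_congr fun c => ?_
    simp [g, zetaStarTerm, Finset.prod_pow_eq_pow_sum]
  · intro n hn
    have h : n.1 0 = n.1 (Fin.last d) := by
      by_contra h
      simp [h] at hn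
    refine ⟨n.1 0 - 1, Subtype.ext (funext fun x => ?_)⟩
    have := n.2.2 0
    have := n.eq_of_first_eq_last h x
    simp only [g]
    omega

end StarRange

/-! ### Telescoping sums. -/

theorem hasSum_sub_shift {f : ℕ → ℝ} (hf : Antitone f)
    (h0 : Filter.Tendsto f Filter.atTop (nhds 0)) (m : ℕ) :
    HasSum (fun r => f r - f (r + m)) (∑ s ∈ range m, f s) := by
  rw [hasSum_iff_tendsto_nat_of_nonneg
    (fun r => sub_nonneg.2 (hf (Nat.le_add_right r m)))]
  -- Both sides come from splitting the sum over `range (N + m)` at `N` and at `m`.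
  have key : ∀ N, ∑ r ∈ range N, (f r - f (r + m))
      = ∑ s ∈ range m, f s - ∑ s ∈ range m, f (s + N) := by
    intro N
    have h1 := Finset.sum_range_add f N m
    have h2 := Finset.sum_range_add f m N
    rw [add_comm m N] at h2
    simp only [sum_sub_distrib, add_comm _ m, add_comm _ N]
    linarith
  simp only [key]
  have : Filter.Tendsto (fun N => ∑ s ∈ range m, f (s + N)) Filter.atTop
      (nhds (∑ s ∈ range m, 0)) :=
    tendsto_finsetSum _ fun s _ => by
      simpa only [Function.comp_def, add_comm s] using h0.comp (Filter.tendsto_add_atTop_nat s)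
  simpa using tendsto_const_nhds.sub this

theorem tsum_ofReal_sub_shift_inv (c m : ℕ) (hc : 0 < c) :
    ∑' r : ℕ, ENNReal.ofReal (1 / ((c + r : ℕ) : ℝ) - 1 / ((c + r + m : ℕ) : ℝ))
      = ENNReal.ofReal (∑ s ∈ range m, 1 / ((c + s : ℕ) : ℝ)) := by
  have hanti : Antitone fun r : ℕ => 1 / ((c + r : ℕ) : ℝ) := fun a b h =>
    one_div_le_one_div_of_le (by positivity) (by gcongr)
  have hlim : Filter.Tendsto (fun r : ℕ => 1 / ((c + r : ℕ) : ℝ)) Filter.atTop (nhds 0) := by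
    have := (tendsto_one_div_atTop_nhds_zero_nat (𝕜 := ℝ)).comp (Filter.tendsto_add_atTop_nat c)
    simpa [Function.comp_def, add_comm] using this
  have hs := hasSum_sub_shift hanti hlim m
  rw [← hs.tsum_eq, ENNReal.ofReal_tsum_of_nonneg
    (fun r => sub_nonneg.2 (hanti (Nat.le_add_right r m))) hs.summable]
  simp only [add_assoc]

/-- The telescoping identity behind the cyclic sum formula. -/
theorem tsum_ofReal_one_div_mul_sub {b m : ℕ} (hm : 1 ≤ m) (hb : m ≤ b) :
    ∑' r : ℕ, ENNReal.ofReal (m / (((b + r : ℕ) : ℝ) * (((b + r : ℕ) : ℝ) - m)))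
      = ∑ p : Fin m, ENNReal.ofReal (1 / ((b : ℝ) - ((p + 1 : ℕ) : ℝ)))
        + if b = m then ENNReal.ofReal (1 / (b : ℝ)) else 0 := by
  rw [Fin.sum_univ_eq_sum_range (fun p => ENNReal.ofReal (1 / ((b : ℝ) - ((p + 1 : ℕ) : ℝ)))) m,
    ← ENNReal.ofReal_sum_of_nonneg]
  swap
  · intro p hp
    have : ((p + 1 : ℕ) : ℝ) ≤ b := by
      have := mem_range.1 hp
      exact_mod_cast (by omega : p + 1 ≤ b)
    exact one_div_nonneg.2 (sub_nonneg.2 this)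
  have split : ∀ c r : ℕ, 0 < c → (m : ℝ) / (((c + r + m : ℕ) : ℝ) * (((c + r + m : ℕ) : ℝ) - m))
      = 1 / ((c + r : ℕ) : ℝ) - 1 / ((c + r + m : ℕ) : ℝ) := by
    intro c r hc
    have h1 : ((c + r : ℕ) : ℝ) ≠ 0 := by positivity
    have h2 : ((c + r : ℕ) : ℝ) + m ≠ 0 := by positivity
    rw [Nat.cast_add (c + r) m, add_sub_cancel_right]
    field_simp
    ring
  rcases hb.eq_or_lt with rfl | hlt
  -- For `b = m` the term `r = 0` is a division by zero, hence `0`, and the series gives the full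
  -- harmonic sum up to `1 / m`. On the right the term `p + 1 = m` is also `0`, so `1 / m` is
  -- missing there: this is the correction term.
  · rw [if_pos rfl, tsum_eq_zero_add' ENNReal.summable]
    have h0 : ENNReal.ofReal (m / (((m + 0 : ℕ) : ℝ) * (((m + 0 : ℕ) : ℝ) - m))) = 0 := by simp
    rw [h0, zero_add, ← ENNReal.ofReal_add _ (by positivity)]
    · have h1 := tsum_ofReal_sub_shift_inv 1 m one_pos
      have h2 : ∀ r : ℕ, (m : ℝ) / (((m + (r + 1) : ℕ) : ℝ) * (((m + (r + 1) : ℕ) : ℝ) - m))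
          = 1 / ((1 + r : ℕ) : ℝ) - 1 / ((1 + r + m : ℕ) : ℝ) := by
        intro r
        rw [← split 1 r one_pos, show m + (r + 1) = 1 + r + m by ring]
      simp only [h2]
      rw [h1]
      congr 1
      obtain ⟨q, rfl⟩ : ∃ q, m = q + 1 := ⟨m - 1, by omega⟩
      rw [sum_range_succ, sum_range_succ, ← sum_range_reflect]
      simp only [sub_self, div_zero, add_zero]
      congr 1
      · refine sum_congr rfl fun p hp => ?_
        have := mem_range.1 hp
        rw [← Nat.cast_sub (by omega)]
        congr 2
        omega
      · rw [add_comm]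
    · refine sum_nonneg fun p hp => ?_
      have : ((p + 1 : ℕ) : ℝ) ≤ m := by exact_mod_cast mem_range.1 hp
      exact one_div_nonneg.2 (sub_nonneg.2 this)
  · rw [if_neg hlt.ne', add_zero]
    have h1 := tsum_ofReal_sub_shift_inv (b - m) m (by omega)
    have h2 : ∀ r : ℕ, (m : ℝ) / (((b + r : ℕ) : ℝ) * (((b + r : ℕ) : ℝ) - m))
        = 1 / ((b - m + r : ℕ) : ℝ) - 1 / ((b - m + r + m : ℕ) : ℝ) := by
      intro r
      rw [← split (b - m) r (by omega), show b - m + r + m = b + r by omega]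
    simp only [h2]
    rw [h1, ← sum_range_reflect]
    congr 1
    refine sum_congr rfl fun p hp => ?_
    have := mem_range.1 hp
    rw [← Nat.cast_sub (by omega)]
    congr 2
    omega

/-! ### Convergence, by comparison with powers of harmonic numbers. -/

/-- Forgetting the order among the later entries, and keeping only that each lies between `1` and
the first, makes the inner sum a product. -/
theorem tsum_chain_le {d : ℕ} (c : ℕ → ENNReal) (g : Fin d → ℕ → ℕ → ENNReal) (H : ℕ → ENNReal)
    (hg : ∀ x a, ∑ b ∈ Icc 1 a, g x a b ≤ H a) :
    ∑' n : StarRange (d + 1), c (n.1 0) * ∏ x, g x (n.1 0) (n.1 x.succ)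
      ≤ ∑' a, c a * H a ^ d := by
  let G : ℕ × (Fin d → ℕ) → ENNReal := fun s =>
    if s.2 ∈ Fintype.piFinset (fun _ => Icc 1 s.1) then c s.1 * ∏ x, g x s.1 (s.2 x) else 0
  let φ : StarRange (d + 1) → ℕ × (Fin d → ℕ) := fun n => (n.1 0, fun x => n.1 x.succ)
  have hφ : Function.Injective φ := fun n n' h => by
    refine Subtype.ext (funext fun x => ?_)
    refine Fin.cases (congrArg Prod.fst h) (fun y => ?_) x
    exact congrFun (congrArg Prod.snd h) y
  have hG : ∀ n : StarRange (d + 1),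
      c (n.1 0) * ∏ x, g x (n.1 0) (n.1 x.succ) = G (φ n) := fun n => by
    have : (φ n).2 ∈ Fintype.piFinset (fun _ => Icc 1 (φ n).1) := by
      simp only [Fintype.mem_piFinset, mem_Icc]
      exact fun x => ⟨n.2.2 _, n.2.1 (Fin.zero_le _)⟩
    simp only [G, if_pos this]
    rfl
  calc _ = ∑' n, G (φ n) := tsum_congr hG
    _ ≤ ∑' s, G s := ENNReal.tsum_comp_le_tsum_of_injective hφ G
    _ = ∑' a, ∑' m, G (a, m) := ENNReal.tsum_prod'
    _ ≤ _ := ENNReal.tsum_le_tsum fun a => ?_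
  rw [tsum_eq_sum (s := Fintype.piFinset (fun _ => Icc 1 a)) (fun m hm => if_neg hm)]
  calc _ = ∑ m ∈ Fintype.piFinset (fun _ => Icc 1 a), c a * ∏ x, g x a (m x) :=
        sum_congr rfl fun m hm => if_pos hm
    _ = c a * ∏ x, ∑ b ∈ Icc 1 a, g x a b := by rw [← mul_sum, prod_univ_sum]
    _ ≤ c a * ∏ x : Fin d, H a := by gcongr; exact hg _ _
    _ = _ := by simp

theorem sum_Icc_one_div (a : ℕ) :
    ∑ b ∈ Icc 1 a, ENNReal.ofReal (1 / (b : ℝ)) = ENNReal.ofReal (harmonic a) := by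
  rw [← ENNReal.ofReal_sum_of_nonneg (fun _ _ => by positivity), harmonic_eq_sum_Icc]
  simp

/-- The term `b = a` is `1 / 0 = 0`; the reflection `b ↦ a - b` turns the others into a shorter
harmonic sum. -/
theorem sum_Icc_one_div_sub_le (a : ℕ) :
    ∑ b ∈ Icc 1 a, ENNReal.ofReal (1 / ((a : ℝ) - b)) ≤ ENNReal.ofReal (harmonic a) := by
  rcases a with _ | a
  · simp
  rw [← sum_Icc_one_div, Finset.sum_Icc_succ_top (by omega), Finset.sum_Icc_succ_top (by omega)]
  simp only [sub_self, div_zero, ENNReal.ofReal_zero, add_zero]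
  refine le_trans (le_of_eq ?_) le_self_add
  refine sum_bij' (fun b _ => a + 1 - b) (fun b _ => a + 1 - b) ?_ ?_ ?_ ?_ ?_
  any_goals intro b hb; rw [mem_Icc] at hb
  · rw [mem_Icc]; omega
  · rw [mem_Icc]; omega
  · omega
  · omega
  · rw [Nat.cast_sub (by omega)]

theorem tsum_harmonic_pow_lt_top (d : ℕ) :
    ∑' a : ℕ, ENNReal.ofReal (1 / (a : ℝ) ^ 2) * ENNReal.ofReal (harmonic a) ^ d < ⊤ := by
  -- Chosen so that `d * ε ≤ 1 / 2`: the `d`-th power of the harmonic number is then `O(a ^ (1 /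
  -- 2))`, leaving the convergent exponent `3 / 2`.
  set ε : ℝ := 1 / (2 * (d + 1)) with hε
  have hε0 : 0 < ε := by positivity
  have hs : Summable fun a : ℕ => (1 + 1 / ε) ^ d * (1 / (a : ℝ) ^ (3 / 2 : ℝ)) :=
    (Real.summable_one_div_nat_rpow.2 (by norm_num)).mul_left _
  refine lt_of_le_of_lt (ENNReal.tsum_le_tsum fun a => ?_) hs.tsum_ofReal_lt_top
  rcases Nat.eq_zero_or_pos a with rfl | ha
  · simp
  have ha1 : (1 : ℝ) ≤ a := by exact_mod_cast ha
  have ha0 : (0 : ℝ) < a := by positivity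
  have hh : (harmonic a : ℝ) ≤ (1 + 1 / ε) * (a : ℝ) ^ ε := by
    have h1 := harmonic_le_one_add_log a
    have h2 := Real.log_le_rpow_div ha0.le hε0
    have h3 := Real.one_le_rpow ha1 hε0.le
    rw [add_mul, one_mul, div_mul_eq_mul_div, one_mul]
    linarith
  have hh0 : (0 : ℝ) ≤ harmonic a := by exact_mod_cast (harmonic_pos ha.ne').le
  rw [← ENNReal.ofReal_pow hh0, ← ENNReal.ofReal_mul (by positivity)]
  refine ENNReal.ofReal_le_ofReal ?_
  have h4 : ((a : ℝ) ^ ε) ^ d ≤ (a : ℝ) ^ (1 / 2 : ℝ) := by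
    rw [← Real.rpow_mul_natCast ha0.le]
    refine Real.rpow_le_rpow_of_exponent_le ha1 ?_
    rw [hε, div_mul_eq_mul_div, div_le_div_iff₀ (by positivity) (by norm_num)]
    linarith
  calc 1 / (a : ℝ) ^ 2 * (harmonic a : ℝ) ^ d
      ≤ 1 / (a : ℝ) ^ 2 * ((1 + 1 / ε) * (a : ℝ) ^ ε) ^ d := by gcongr
    _ = (1 + 1 / ε) ^ d * (1 / (a : ℝ) ^ 2 * ((a : ℝ) ^ ε) ^ d) := by rw [mul_pow]; ring
    _ ≤ (1 + 1 / ε) ^ d * (1 / (a : ℝ) ^ 2 * (a : ℝ) ^ (1 / 2 : ℝ)) := by gcongr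
    _ = _ := by
      congr 1
      have : (a : ℝ) ^ 2 = (a : ℝ) ^ (3 / 2 : ℝ) * (a : ℝ) ^ (1 / 2 : ℝ) := by
        rw [← Real.rpow_add ha0, ← Real.rpow_natCast]
        norm_num
      rw [this]
      field_simp

theorem zetaStarTerm_nonneg {d : ℕ} (e : Fin d → ℕ) (n : StarRange d) : 0 ≤ zetaStarTerm e n := by
  unfold zetaStarTerm
  positivity

theorem tsum_zetaStarTerm_lt_top {d : ℕ} (e : Fin (d + 1) → ℕ) (h0 : 2 ≤ e 0)
    (he : ∀ x, 1 ≤ e x) : ∑' n, ENNReal.ofReal (zetaStarTerm e n) < ⊤ := by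
  refine lt_of_le_of_lt ?_ ((tsum_chain_le (d := d) (fun a => ENNReal.ofReal (1 / (a : ℝ) ^ 2))
    (fun _ _ b => ENNReal.ofReal (1 / (b : ℝ))) (fun a => ENNReal.ofReal (harmonic a))
    (fun _ a => (sum_Icc_one_div a).le)).trans_lt (tsum_harmonic_pow_lt_top d))
  refine ENNReal.tsum_le_tsum fun n => ?_
  rw [← ENNReal.ofReal_prod_of_nonneg (fun _ _ => by positivity),
    ← ENNReal.ofReal_mul (by positivity)]
  refine ENNReal.ofReal_le_ofReal ?_
  have hn : ∀ x, (1 : ℝ) ≤ n.1 x := fun x => by exact_mod_cast n.2.2 x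
  have hn' := n.pos
  rw [zetaStarTerm, Fin.prod_univ_succ, prod_div_distrib, div_mul_div_comm]
  simp only [prod_const_one, mul_one]
  refine one_div_le_one_div_of_le (mul_pos (pow_pos (hn' _) _) (prod_pos fun x _ => hn' _)) ?_
  gcongr with x
  · exact hn 0
  · exact le_self_pow₀ (hn _) (Nat.one_le_iff_ne_zero.1 (he _))

/-- The general term `1 / (n₁ ^ (k₁ - i) n₂ ^ k₂ ⋯ n_l ^ k_l m ^ i (n₁ - m))` of the auxiliary
series of Ohno and Wakabayashi, over chains `n₁ ≥ ⋯ ≥ n_l ≥ m`; it is zero when `n₁ = m`. -/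
noncomputable def cyclicTerm {L : ℕ} (k : Fin (L + 1) → ℕ) (i : ℕ) (n : StarRange (L + 2)) : ℝ :=
  1 / ((n.1 0 : ℝ) ^ (k 0 - i) * (∏ x : Fin L, (n.1 x.succ.castSucc : ℝ) ^ k x.succ) *
    (n.1 (Fin.last _) : ℝ) ^ i * ((n.1 0 : ℝ) - n.1 (Fin.last _)))

theorem cyclicTerm_nonneg {L : ℕ} (k : Fin (L + 1) → ℕ) (i : ℕ) (n : StarRange (L + 2)) :
    0 ≤ cyclicTerm k i n := by
  have : (0 : ℝ) ≤ (n.1 0 : ℝ) - n.1 (Fin.last _) :=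
    sub_nonneg.2 (Nat.cast_le.2 (n.2.1 (Fin.zero_le _)))
  unfold cyclicTerm
  positivity

theorem tsum_cyclicTerm_lt_top {L : ℕ} (k : Fin (L + 1) → ℕ) (h0 : 2 ≤ k 0)
    (hk : ∀ x, 1 ≤ k x) : ∑' n, ENNReal.ofReal (cyclicTerm k 0 n) < ⊤ := by
  -- With `i = 0` the last entry occurs only in the factor `1 / (n₁ - m)`, whose sum over `m` is
  -- again bounded by a harmonic number.
  let g : Fin (L + 1) → ℕ → ℕ → ENNReal := Fin.snoc (α := fun _ => ℕ → ℕ → ENNReal)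
    (fun _ _ b => ENNReal.ofReal (1 / (b : ℝ))) (fun a b => ENNReal.ofReal (1 / ((a : ℝ) - b)))
  have hg : ∀ x a, ∑ b ∈ Icc 1 a, g x a b ≤ ENNReal.ofReal (harmonic a) := by
    intro x a
    refine Fin.lastCases ?_ (fun y => ?_) x
    · simpa [g] using sum_Icc_one_div_sub_le a
    · simpa [g] using (sum_Icc_one_div a).le
  refine lt_of_le_of_lt ?_ ((tsum_chain_le (fun a => ENNReal.ofReal (1 / (a : ℝ) ^ 2))
    g (fun a => ENNReal.ofReal (harmonic a)) hg).trans_lt (tsum_harmonic_pow_lt_top _))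
  refine ENNReal.tsum_le_tsum fun n => ?_
  have hn : ∀ x, (1 : ℝ) ≤ n.1 x := fun x => by exact_mod_cast n.2.2 x
  have hn' := n.pos
  have hsub : (0 : ℝ) ≤ (n.1 0 : ℝ) - n.1 (Fin.last _) :=
    sub_nonneg.2 (Nat.cast_le.2 (n.2.1 (Fin.zero_le _)))
  rw [Fin.prod_univ_castSucc]
  simp only [g, Fin.snoc_castSucc, Fin.snoc_last, Fin.succ_last]
  rw [← ENNReal.ofReal_prod_of_nonneg (fun _ _ => by positivity),
    ← ENNReal.ofReal_mul (prod_nonneg fun _ _ => by positivity),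
    ← ENNReal.ofReal_mul (by positivity)]
  refine ENNReal.ofReal_le_ofReal ?_
  rw [cyclicTerm, pow_zero, mul_one, Nat.sub_zero, prod_div_distrib, ← mul_assoc, div_mul_div_comm,
    ← one_div_mul_one_div, prod_const_one, mul_one]
  refine mul_le_mul_of_nonneg_right ?_ (one_div_nonneg.2 hsub)
  refine one_div_le_one_div_of_le (mul_pos (pow_pos (hn' _) _) (prod_pos fun x _ => hn' _)) ?_
  gcongr with x
  · exact hn 0
  · exact le_self_pow₀ (hn _) (Nat.one_le_iff_ne_zero.1 (hk _))

/-! ### Moving powers from the first entry to the last. -/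

theorem Fin.sum_add_one_eq {M : Type*} [AddCommMonoid M] {L : ℕ} (f : Fin (L + 1) → M) :
    ∑ x, f (x + 1) = ∑ x, f x :=
  Equiv.sum_comp (Equiv.addRight (1 : Fin (L + 1))) f

theorem zetaStarTerm_snoc_update {L : ℕ} (k : Fin (L + 1) → ℕ) (q r : ℕ)
    (n : StarRange (L + 2)) :
    zetaStarTerm (Fin.snoc (α := fun _ => ℕ) (Function.update k 0 q) r) n
      = 1 / ((n.1 0 : ℝ) ^ q * (∏ x : Fin L, (n.1 x.succ.castSucc : ℝ) ^ k x.succ) *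
        (n.1 (Fin.last _) : ℝ) ^ r) := by
  rw [zetaStarTerm, Fin.prod_univ_castSucc, Fin.prod_univ_succ]
  simp only [Fin.snoc_castSucc, Fin.snoc_last, Function.update_self,
    Function.update_of_ne (Fin.succ_ne_zero _)]
  simp

/-- Off the diagonal, with `a = n₁`, this is `1 / (a (a - m)) + 1 / (a m) = 1 / (m (a - m))` times
common factors. -/
theorem cyclicTerm_add {L : ℕ} (k : Fin (L + 1) → ℕ) {i : ℕ} (hi : i < k 0)
    (n : StarRange (L + 2)) :
    cyclicTerm k i n + (if n.1 0 = n.1 (Fin.last _) then 0 else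
      zetaStarTerm (Fin.snoc (α := fun _ => ℕ) (Function.update k 0 (k 0 - i)) (i + 1)) n)
      = cyclicTerm k (i + 1) n := by
  rw [zetaStarTerm_snoc_update]
  unfold cyclicTerm
  have hG : (∏ x : Fin L, (n.1 x.succ.castSucc : ℝ) ^ k x.succ) ≠ 0 :=
    (prod_pos fun x _ => pow_pos (n.pos _) _).ne'
  generalize (∏ x : Fin L, (n.1 x.succ.castSucc : ℝ) ^ k x.succ) = G at hG
  have ha := (n.pos 0).ne'
  have hm := (n.pos (Fin.last _)).ne'
  split_ifs with h
  · simp [h]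
  · have hs : (n.1 0 : ℝ) - n.1 (Fin.last _) ≠ 0 := sub_ne_zero.2 (Nat.cast_injective.ne h)
    obtain ⟨q, hq⟩ : ∃ q, k 0 = q + i + 1 := ⟨k 0 - i - 1, by omega⟩
    rw [hq, show q + i + 1 - i = q + 1 by omega, show q + i + 1 - (i + 1) = q by omega]
    field_simp
    ring

/-- The series `∑ 1 / c ^ s` over positive integers `c`, with values in `[0, ∞]`. -/
noncomputable def zetaENNReal (s : ℕ) : ENNReal :=
  ∑' c : ℕ, ENNReal.ofReal (1 / ((c + 1 : ℕ) : ℝ) ^ s)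

theorem tsum_zetaStarTerm_eq_add {d : ℕ} (e : Fin (d + 1) → ℕ) :
    ∑' n, ENNReal.ofReal (zetaStarTerm e n)
      = ∑' n : StarRange (d + 1), ENNReal.ofReal
          (if n.1 0 = n.1 (Fin.last _) then 0 else zetaStarTerm e n)
        + zetaENNReal (∑ x, e x) := by
  rw [zetaENNReal, ← StarRange.tsum_diagonal, ← ENNReal.tsum_add]
  refine tsum_congr fun n => ?_
  split_ifs <;> simp

theorem sum_snoc_update {L : ℕ} (k : Fin (L + 1) → ℕ) {i : ℕ} (hi : i < k 0) :
    ∑ x, Fin.snoc (α := fun _ => ℕ) (Function.update k 0 (k 0 - i)) (i + 1) x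
      = ∑ x, k x + 1 := by
  rw [Fin.sum_univ_castSucc, Fin.sum_univ_succ, Fin.sum_univ_succ]
  simp only [Fin.snoc_castSucc, Fin.snoc_last, Function.update_self,
    Function.update_of_ne (Fin.succ_ne_zero _)]
  omega

theorem tsum_cyclicTerm_add {L : ℕ} (k : Fin (L + 1) → ℕ) {q : ℕ} (hq : q ≤ k 0) :
    ∑' n, ENNReal.ofReal (cyclicTerm k 0 n) + ∑ i ∈ range q, ∑' n, ENNReal.ofReal (zetaStarTerm
        (Fin.snoc (α := fun _ => ℕ) (Function.update k 0 (k 0 - i)) (i + 1)) n)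
      = ∑' n, ENNReal.ofReal (cyclicTerm k q n) + q * zetaENNReal (∑ x, k x + 1) := by
  induction q with
  | zero => simp
  | succ i ih =>
    have hi : i < k 0 := hq
    rw [sum_range_succ, ← add_assoc, ih hi.le, tsum_zetaStarTerm_eq_add, sum_snoc_update k hi,
      Nat.cast_succ, add_one_mul, ← add_assoc, ← add_assoc]
    congr 1
    rw [add_right_comm]
    congr 1
    rw [← ENNReal.tsum_add]
    refine tsum_congr fun n => ?_
    rw [← cyclicTerm_add k hi n, ENNReal.ofReal_add (cyclicTerm_nonneg _ _ _)]
    split_ifs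
    · exact le_rfl
    · exact zetaStarTerm_nonneg _ _

/-! ### Rotation of the index by telescoping. -/

theorem zetaStarTerm_rotate {L : ℕ} (k : Fin (L + 1) → ℕ) (t : StarRange (L + 1)) :
    zetaStarTerm (fun m => k (m + 1)) t
      = 1 / ((∏ x : Fin L, (t.1 x.castSucc : ℝ) ^ k x.succ) * (t.1 (Fin.last L) : ℝ) ^ k 0) := by
  rw [zetaStarTerm, Fin.prod_univ_castSucc]
  simp only [Fin.last_add_one, Fin.coeSucc_eq_succ]

theorem cyclicTerm_consEquiv {L : ℕ} (k : Fin (L + 1) → ℕ) (h0 : 1 ≤ k 0)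
    (t : StarRange (L + 1)) (r : ℕ) :
    cyclicTerm k (k 0 - 1) (StarRange.consEquiv L (t, r))
      = zetaStarTerm (fun m => k (m + 1)) t * (t.1 (Fin.last L) /
        (((t.1 0 + r : ℕ) : ℝ) * (((t.1 0 + r : ℕ) : ℝ) - t.1 (Fin.last L)))) := by
  rw [zetaStarTerm_rotate]
  simp only [cyclicTerm, StarRange.consEquiv_val, Fin.cons_zero, ← Fin.succ_castSucc,
    ← Fin.succ_last, Fin.cons_succ]
  obtain ⟨q, hq⟩ : ∃ q, k 0 = q + 1 := ⟨k 0 - 1, by omega⟩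
  have hm := (t.pos (Fin.last _)).ne'
  rw [hq, show q + 1 - (q + 1 - 1) = 1 by omega, Nat.add_sub_cancel, pow_one, div_mul_div_comm,
    pow_succ, one_mul, ← mul_div_mul_right 1 _ hm, one_mul]
  congr 1
  ring

theorem cyclicTerm_snocChain {L : ℕ} (k : Fin (L + 1) → ℕ) (t : StarRange (L + 1))
    (p : Fin (t.1 (Fin.last L))) :
    cyclicTerm k 0 (StarRange.snocChain t p)
      = zetaStarTerm k t * (1 / ((t.1 0 : ℝ) - ((p + 1 : ℕ) : ℝ))) := by
  rw [zetaStarTerm, Fin.prod_univ_succ, one_div_mul_one_div]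
  simp only [cyclicTerm, StarRange.snocChain, Fin.snoc_last, Fin.snoc_castSucc, pow_zero, mul_one,
    Nat.sub_zero]
  rw [← Fin.castSucc_zero, Fin.snoc_castSucc]

theorem zetaStarTerm_mul_one_div {L : ℕ} (k : Fin (L + 1) → ℕ) (t : StarRange (L + 1)) :
    zetaStarTerm k t * (1 / (t.1 0 : ℝ)) = zetaStarTerm (k + Pi.single 0 1) t := by
  simp only [zetaStarTerm, Pi.add_apply, pow_add, prod_mul_distrib, one_div_mul_one_div]
  congr 2
  rw [prod_eq_single 0] <;> simp +contextual

/-- Both series are fibred over the same chains `t`: the left one by the entry before `t`, the right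
one by the entry after it. `tsum_ofReal_one_div_mul_sub` compares the fibres, and its correction at
constant `t` sums to the zeta value. -/
theorem tsum_cyclicTerm_rotate {L : ℕ} (k : Fin (L + 1) → ℕ) (h0 : 1 ≤ k 0) :
    ∑' n, ENNReal.ofReal (cyclicTerm k (k 0 - 1) n)
      = ∑' n, ENNReal.ofReal (cyclicTerm (fun m => k (m + 1)) 0 n)
        + zetaENNReal (∑ x, k x + 1) := by
  have hsum : ∑ x, ((fun m => k (m + 1)) + Pi.single 0 1 : Fin (L + 1) → ℕ) x = ∑ x, k x + 1 := by
    simp only [Pi.add_apply, sum_add_distrib]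
    rw [Fin.sum_add_one_eq k]
    simp
  rw [StarRange.tsum_eq_cons, StarRange.tsum_eq_snoc, zetaENNReal, ← hsum,
    ← StarRange.tsum_diagonal, ← ENNReal.tsum_add]
  refine tsum_congr fun t => ?_
  simp only [cyclicTerm_consEquiv k h0, cyclicTerm_snocChain,
    ENNReal.ofReal_mul (zetaStarTerm_nonneg (fun m => k (m + 1)) t), ENNReal.tsum_mul_left]
  rw [tsum_ofReal_one_div_mul_sub (t.2.2 _) (t.2.1 (Fin.zero_le _)), mul_add, mul_sum]
  congr 1
  rw [← zetaStarTerm_mul_one_div, ENNReal.ofReal_mul (zetaStarTerm_nonneg _ t)]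
  split_ifs <;> simp

/-! ### One cyclic shift, and the sum over all shifts. -/

theorem cyclicIndex_eq_snoc {L : ℕ} (k : Fin (L + 1) → ℕ) (j : Fin (L + 1)) (i : ℕ)
    (hi : i + 1 ≤ k j) :
    cyclicIndex k j (i + 1) = Fin.snoc (α := fun _ => ℕ)
      (Function.update (fun m => k (j + m)) 0 (k (j + 0) - i)) (i + 1) := by
  rw [cyclicIndex, add_zero, show k j - (i + 1) + 1 = k j - i by omega]

/-- The effect of one cyclic shift on the auxiliary series. -/
theorem tsum_cyclicTerm_shift {L : ℕ} (k : Fin (L + 1) → ℕ) (hpos : ∀ j, 1 ≤ k j)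
    (j : Fin (L + 1)) :
    ∑' n, ENNReal.ofReal (cyclicTerm (fun m => k (j + m)) 0 n)
        + ∑ i ∈ Icc 1 (k j - 1), ∑' n, ENNReal.ofReal (zetaStarTerm (cyclicIndex k j i) n)
      = ∑' n, ENNReal.ofReal (cyclicTerm (fun m => k (j + 1 + m)) 0 n)
        + k j * zetaENNReal (∑ x, k x + 1) := by
  have hsum : ∑ x, k (j + x) = ∑ x, k x := Equiv.sum_comp (Equiv.addLeft j) k
  have h1 := tsum_cyclicTerm_add (fun m => k (j + m)) (q := k j - 1) (by simp)
  have h2 := tsum_cyclicTerm_rotate (fun m => k (j + m)) (hpos _)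
  have h3 : ∑ i ∈ Icc 1 (k j - 1), ∑' n, ENNReal.ofReal (zetaStarTerm (cyclicIndex k j i) n)
      = ∑ i ∈ range (k j - 1), ∑' n, ENNReal.ofReal (zetaStarTerm
        (Fin.snoc (α := fun _ => ℕ)
          (Function.update (fun m => k (j + m)) 0 (k (j + 0) - i)) (i + 1)) n) := by
    rw [← Finset.Ico_succ_right_eq_Icc, Finset.sum_Ico_eq_sum_range]
    refine sum_congr (by simp) fun i hi => ?_
    rw [mem_range] at hi
    rw [add_comm 1 i, cyclicIndex_eq_snoc k j i (by omega)]
  rw [h3, h1]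
  simp only [add_zero, hsum] at h2
  -- One zeta value from the rotation and `k j - 1` from the diagonals make `k j`.
  rw [h2, hsum, add_assoc, ← one_add_mul]
  congr 2
  · simp only [add_assoc, add_comm (1 : Fin (L + 1))]
  · have := hpos j
    exact_mod_cast (by omega : 1 + (k j - 1) = k j)

theorem tsum_cyclicIndex_lt_top {L : ℕ} (k : Fin (L + 1) → ℕ) (hpos : ∀ j, 1 ≤ k j)
    (j : Fin (L + 1)) {i : ℕ} (hi : i ∈ Icc 1 (k j - 1)) :
    ∑' n, ENNReal.ofReal (zetaStarTerm (cyclicIndex k j i) n) < ⊤ := by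
  rw [mem_Icc] at hi
  refine tsum_zetaStarTerm_lt_top _ ?_ fun x => ?_
  · rw [cyclicIndex, ← Fin.castSucc_zero (n := L + 1), Fin.snoc_castSucc, Function.update_self]
    omega
  · refine Fin.lastCases ?_ (fun y => ?_) x
    · rw [cyclicIndex, Fin.snoc_last]
      exact hi.1
    · rw [cyclicIndex, Fin.snoc_castSucc, Function.update_apply]
      split_ifs
      · omega
      · exact hpos _

-- The direct bound needs a leading exponent at least `2`, which holds at `j₀`. The shift identity
-- then carries finiteness from each rotation to the next, even where the leading exponent is `1`,
-- and so around the whole cycle.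
open Fin.CommRing in
theorem tsum_cyclicTerm_ne_top {L : ℕ} (k : Fin (L + 1) → ℕ) (hpos : ∀ j, 1 ≤ k j)
    (hne : ∃ j, k j ≠ 1) (j : Fin (L + 1)) :
    ∑' n, ENNReal.ofReal (cyclicTerm (fun m => k (j + m)) 0 n) ≠ ⊤ := by
  obtain ⟨j₀, hj₀⟩ := hne
  have h1 : 1 < ∑ x, k x + 1 :=
    Nat.lt_add_of_pos_left (sum_pos (fun x _ => hpos x) univ_nonempty)
  suffices ∀ s : ℕ, ∑' n, ENNReal.ofReal
      (cyclicTerm (fun m => k (j₀ + (s : Fin (L + 1)) + m)) 0 n) ≠ ⊤ by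
    simpa using this (j - j₀).val
  intro s
  induction s with
  | zero =>
    refine (tsum_cyclicTerm_lt_top _ ?_ fun x => hpos _).ne
    have := hpos j₀
    simp only [Nat.cast_zero, add_zero]
    omega
  | succ s ih =>
    rw [Nat.cast_succ, ← add_assoc]
    have h := tsum_cyclicTerm_shift k hpos (j₀ + (s : Fin (L + 1)))
    have hfin := ENNReal.add_ne_top.2 ⟨ih, (ENNReal.sum_lt_top.2 fun i hi =>
      tsum_cyclicIndex_lt_top k hpos (j₀ + (s : Fin (L + 1))) hi).ne⟩
    rw [h] at hfin
    exact (ENNReal.add_ne_top.1 hfin).1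

/-- The cyclic sum formula with values in `[0, ∞]`. -/
theorem sum_tsum_cyclicIndex {L : ℕ} (k : Fin (L + 1) → ℕ) (hpos : ∀ j, 1 ≤ k j)
    (hne : ∃ j, k j ≠ 1) :
    ∑ j, ∑ i ∈ Icc 1 (k j - 1), ∑' n, ENNReal.ofReal (zetaStarTerm (cyclicIndex k j i) n)
      = ((∑ j, k j : ℕ) : ENNReal) * zetaENNReal (∑ j, k j + 1) := by
  have h := sum_congr (rfl : (univ : Finset (Fin (L + 1))) = univ)
    fun j _ => tsum_cyclicTerm_shift k hpos j
  rw [sum_add_distrib, sum_add_distrib, Fin.sum_add_one_eq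
    (fun j => ∑' n, ENNReal.ofReal (cyclicTerm (fun m => k (j + m)) 0 n)), ← sum_mul] at h
  rw [Nat.cast_sum]
  exact (ENNReal.add_right_inj
    (ENNReal.sum_ne_top.2 fun j _ => tsum_cyclicTerm_ne_top k hpos hne j)).1 h

/-! ### Return to real series and the Riemann zeta function. -/

theorem toReal_tsum_ofReal {ι : Type*} {f : ι → ℝ} (hf : ∀ x, 0 ≤ f x) :
    (∑' x, ENNReal.ofReal (f x)).toReal = ∑' x, f x := by
  rw [ENNReal.tsum_toReal_eq fun _ => ENNReal.ofReal_ne_top]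
  exact tsum_congr fun x => ENNReal.toReal_ofReal (hf x)

theorem summable_of_tsum_ofReal_ne_top {ι : Type*} {f : ι → ℝ} (hf : ∀ x, 0 ≤ f x)
    (h : ∑' x, ENNReal.ofReal (f x) ≠ ⊤) : Summable f :=
  (ENNReal.summable_toReal h).congr fun x => ENNReal.toReal_ofReal (hf x)

theorem riemannZeta_eq_toReal {s : ℕ} (hs : 1 < s) :
    riemannZeta s = ((zetaENNReal s).toReal : ℂ) := by
  rw [zeta_nat_eq_tsum_of_gt_one hs, zetaENNReal, toReal_tsum_ofReal fun c => by positivity,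
    Complex.ofReal_tsum, Summable.tsum_eq_zero_add]
  · simp [Nat.ne_zero_of_lt hs]
  · simpa using Complex.summable_ofReal.2 (Real.summable_one_div_nat_pow.2 hs)

theorem mainTheorem5 (l : ℕ) [NeZero l] (k : Fin l → ℕ)
    (hpos : ∀ j, 1 ≤ k j) (hne : ∃ j, k j ≠ 1) :
    (∀ j, ∀ i ∈ Finset.Icc 1 (k j - 1), Summable (zetaStarTerm (cyclicIndex k j i))) ∧
    ((∑ j : Fin l, ∑ i ∈ Finset.Icc 1 (k j - 1), zetaStar (cyclicIndex k j i) : ℝ) : ℂ)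
      = ((∑ j : Fin l, k j : ℕ) : ℂ) * riemannZeta (((∑ j : Fin l, k j : ℕ) : ℂ) + 1) := by
  obtain ⟨L, rfl⟩ : ∃ L, l = L + 1 := Nat.exists_eq_succ_of_ne_zero (NeZero.ne l)
  have h1 : 1 < ∑ x, k x + 1 :=
    Nat.lt_add_of_pos_left (sum_pos (fun x _ => hpos x) univ_nonempty)
  refine ⟨fun j i hi => summable_of_tsum_ofReal_ne_top (zetaStarTerm_nonneg _)
    (tsum_cyclicIndex_lt_top k hpos j hi).ne, ?_⟩
  rw [← Nat.cast_succ, riemannZeta_eq_toReal h1, ← Complex.ofReal_natCast, ← Complex.ofReal_mul]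
  congr 1
  have h := congrArg ENNReal.toReal (sum_tsum_cyclicIndex k hpos hne)
  rw [ENNReal.toReal_mul, ENNReal.toReal_natCast] at h
  rw [← h, ENNReal.toReal_sum fun j _ => (ENNReal.sum_lt_top.2 fun i hi =>
    tsum_cyclicIndex_lt_top k hpos j hi).ne]
  refine sum_congr rfl fun j _ => ?_
  rw [ENNReal.toReal_sum fun i hi => (tsum_cyclicIndex_lt_top k hpos j hi).ne]
  exact sum_congr rfl fun i _ => (toReal_tsum_ofReal (zetaStarTerm_nonneg _)).symm
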